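/- **Second no-hair theorem.** Let $\mathfrak g$ be a three-dimensional solvable real Lie algebra (Bianchi types I–VII$_h$), and consider a Bianchi space-time with isometry algebra $\mathfrak g$ and line element $ds^2=-dt^2+\delta_{ab}\,\omega^a\omega^b$, where $\mathbf e_a(t)$ is a time-dependent $C^2$ basis of the Lie algebra $\mathfrak g$ of invariant vector fields, $\omega^a$ is dual to it, $\mathbf e_0=\partial_t$ and $[\mathbf e_\mu,\mathbf e_\nu]=\gamma^\rho{}_{\mu\nu}\mathbf e_\rho$. Suppose it is defined for all cosmological times $t>t_i$ and solves there Einstein's equations ($8\pi G=c=1$, no cosmological constant) $$R_{\mu\nu}-\tfrac12 R\,g_{\mu\nu}=T^{\rm pf}_{\mu\nu}+T^{\rm jf}_{\mu\nu},$$ where $T^{\rm pf}_{\mu\nu}=(\rho+p)u_\mu u_\nu+p\,g_{\mu\nu}$ is a perfect fluid comoving with $\mathbf u=\partial_t$, with $p=(\gamma-1)\rho$ and $0\le\gamma<2/3$, and $T^{\rm jf}_{\mu\nu}=\mathcal J_\mu\mathcal J_\nu-\tfrac12 g_{\mu\nu}\mathcal J_\lambda\mathcal J^\lambda$ is a $j$-form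 fluid with spatially homogeneous $\mathcal J_\mu$ (a 1-form field strength, or the Hodge dual of a 3-form field strength) satisfying $\nabla_{[\mu}\mathcal J_{\nu]}=0$ and $\nabla_\mu\mathcal J^\mu=0$; the two fluids do not interact, so $\nabla^\mu T^{\rm pf}_{\mu\nu}=0$. Let $H=\tfrac13\nabla_\mu u^\mu$ be the Hubble parameter, $\sigma_{ab}$ the shear of $\mathbf u$, and $q$ the deceleration parameter, $dH/dt=-(1+q)H^2$. Suppose that at some time $t_0>t_i$ the space-time is expanding, $H(t_0)>0$, and the fluid is present, $\rho(t_0)>0$. Then $H(t)>0$ for all $t\ge t_0$, the dimensionless time $\tau=\int_{t_0}^tH\,ds$ tends to infinity as $t\to\infty$, and the space-time is asymptotically quasi de Sitter: as $t\to\infty$, $$q\to\tfrac32\gamma-1<0,\qquad \Omega_{\rm pf}=\frac{\rho}{3H^2}\to1,\qquad \frac{\sigma_{ab}}{H}\to0,\qquad \frac{\gamma^a{}_{bc}}{H}\to0,\qquad \frac{\mathcal J_\mu}{H}\to0$$ for all spatial indices $a,b,c$ and all $\mu$. -/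

import Mathlib

open Set Filter Topology

noncomputable section

namespace Bianchi

/-! ### Geometry of a spatially homogeneous orthonormal tetrad

Index `0 : Fin 4` is the time direction and `a.succ` (for `a : Fin 3`) are the spatial directions.
All frame components below depend on cosmological time `t` only. -/

/-- The components `η_{μν} = η^{μν} = diag(-1, 1, 1, 1)` of the metric in an orthonormal tetrad. -/
def eta (μ ν : Fin 4) : ℝ := if μ = ν then (if μ = 0 then -1 else 1) else 0

/-- Action of the tetrad vector `e_μ` on a function of `t`: `e_0 = ∂/∂t`, and the spatial vectors,
being tangent to the surfaces of homogeneity, annihilate it. -/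
def frameDeriv (μ : Fin 4) (f : ℝ → ℝ) (t : ℝ) : ℝ := if μ = 0 then deriv f t else 0

/-- Structure coefficients of a tetrad: `c t ρ μ ν` is `γ^ρ_{μν}(t)` in
`[e_μ, e_ν] = γ^ρ_{μν} e_ρ`. -/
abbrev StructureCoeffs := ℝ → Fin 4 → Fin 4 → Fin 4 → ℝ

/-- Structure coefficients with the first index lowered, `γ_{ρμν}`. -/
def lowered (c : StructureCoeffs) (t : ℝ) (ρ μ ν : Fin 4) : ℝ := ∑ l, eta ρ l * c t l μ ν

/-- Levi-Civita connection of the metric for which the tetrad is orthonormal (Koszul formula):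
`∇_{e_μ} e_ν = Γ^ρ_{μν} e_ρ`, where `Γ^ρ_{μν}` is `christoffel c t ρ μ ν`. -/
def christoffel (c : StructureCoeffs) (t : ℝ) (ρ μ ν : Fin 4) : ℝ :=
  ∑ l, eta ρ l * ((lowered c t l μ ν - lowered c t μ ν l + lowered c t ν l μ) / 2)

/-- Riemann tensor `R^ρ_{σμν}`, the `ρ`-component of
`∇_{e_μ}∇_{e_ν} e_σ - ∇_{e_ν}∇_{e_μ} e_σ - ∇_{[e_μ, e_ν]} e_σ`. -/
def riemann (c : StructureCoeffs) (t : ℝ) (ρ σ μ ν : Fin 4) : ℝ :=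
  frameDeriv μ (fun s => christoffel c s ρ ν σ) t
    - frameDeriv ν (fun s => christoffel c s ρ μ σ) t
    + ∑ l, (christoffel c t l ν σ * christoffel c t ρ μ l
        - christoffel c t l μ σ * christoffel c t ρ ν l
        - c t l μ ν * christoffel c t ρ l σ)

/-- Ricci tensor `R_{σν} = R^μ_{σμν}`. -/
def ricci (c : StructureCoeffs) (t : ℝ) (σ ν : Fin 4) : ℝ := ∑ μ, riemann c t μ σ μ ν

/-- Ricci scalar. -/
def scalarCurv (c : StructureCoeffs) (t : ℝ) : ℝ := ∑ μ, ∑ ν, eta μ ν * ricci c t μ ν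

/-- Einstein tensor `R_{μν} - R g_{μν} / 2`. -/
def einstein (c : StructureCoeffs) (t : ℝ) (μ ν : Fin 4) : ℝ :=
  ricci c t μ ν - scalarCurv c t * eta μ ν / 2

/-- Covariant derivative `∇_μ J_ν` of a one-form. -/
def covDerivForm (c : StructureCoeffs) (J : ℝ → Fin 4 → ℝ) (t : ℝ) (μ ν : Fin 4) : ℝ :=
  frameDeriv μ (fun s => J s ν) t - ∑ l, christoffel c t l μ ν * J t l

/-- Covariant derivative `∇_l T_{μν}` of a covariant two-tensor. -/
def covDerivTensor (c : StructureCoeffs) (T : ℝ → Fin 4 → Fin 4 → ℝ) (t : ℝ) (l μ ν : Fin 4) : ℝ :=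
  frameDeriv l (fun s => T s μ ν) t
    - ∑ k, (christoffel c t k l μ * T t k ν + christoffel c t k l ν * T t μ k)

/-! ### Matter -/

/-- Covariant components of the four-velocity `u = ∂/∂t` of the fundamental observers. -/
def fourVelocity (μ : Fin 4) : ℝ := eta μ 0

/-- Energy-momentum tensor of the comoving perfect fluid with density `ρ` and pressure
`p = (γ - 1) ρ`. -/
def fluidStress (γ : ℝ) (ρ : ℝ → ℝ) (t : ℝ) (μ ν : Fin 4) : ℝ :=
  (ρ t + (γ - 1) * ρ t) * fourVelocity μ * fourVelocity ν + (γ - 1) * ρ t * eta μ ν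

/-- Energy-momentum tensor `J_μ J_ν - g_{μν} J_l J^l / 2` of the `j`-form. -/
def formStress (J : ℝ → Fin 4 → ℝ) (t : ℝ) (μ ν : Fin 4) : ℝ :=
  J t μ * J t ν - eta μ ν * (∑ k, ∑ l, eta k l * J t k * J t l) / 2

/-! ### Bianchi space-times -/

/-- Structure coefficients of the tetrad `e_0 = ∂/∂t`, `e_{a.succ} = e t a` on `ℝ × G`, where `𝔤` is
the Lie algebra of invariant vector fields on the three-dimensional Lie group `G` and `e t` is, for
each `t`, a basis of `𝔤`. One has `[e_b, e_c] = ⁅e t b, e t c⁆` and `[∂/∂t, e_c] = d/dt (e t c)`,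
and no commutator has a component along `∂/∂t`. -/
def structureCoeffs {𝔤 : Type*} [LieRing 𝔤] [LieAlgebra ℝ 𝔤]
    (e : ℝ → Module.Basis (Fin 3) ℝ 𝔤) : StructureCoeffs := fun t ρ μ ν =>
  Fin.cases 0 (fun a =>
    Fin.cases
      (Fin.cases 0 (fun c => deriv (fun s => (e t).repr (e s c) a) t) ν)
      (fun b => Fin.cases (-deriv (fun s => (e t).repr (e s b) a) t)
        (fun c => (e t).repr ⁅e t b, e t c⁆ a) ν) μ) ρ

/-- A solution, for all cosmological times `t > tᵢ`, of the Einstein equations (`8πG = c = 1`,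
no cosmological constant) on a Bianchi space-time whose isometry group has Lie algebra `𝔤`, with
line element `-dt² + δ_{ab} ω^a ω^b` (`ω^a` dual to the orthonormal frame `e_a`), sourced by
a comoving perfect fluid with `p = (γ - 1) ρ` and a homogeneous `j`-form `J_μ`, the two being
non-interacting. -/
structure JFormSpacetime (𝔤 : Type*) [LieRing 𝔤] [LieAlgebra ℝ 𝔤] (γ tᵢ : ℝ) where
  /-- the spatial part of the orthonormal tetrad -/
  e : ℝ → Module.Basis (Fin 3) ℝ 𝔤
  /-- the energy density of the perfect fluid -/
  ρ : ℝ → ℝ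
  /-- the tetrad components `J_μ` of the `j`-form -/
  J : ℝ → Fin 4 → ℝ
  contDiff_e : ∀ (φ : Module.Dual ℝ 𝔤) (a : Fin 3), ContDiffOn ℝ 2 (fun t => φ (e t a)) (Ioi tᵢ)
  differentiable_ρ : DifferentiableOn ℝ ρ (Ioi tᵢ)
  differentiable_J : ∀ μ, DifferentiableOn ℝ (fun t => J t μ) (Ioi tᵢ)
  /-- `R_{μν} - R g_{μν} / 2 = T^{pf}_{μν} + T^{jf}_{μν}` -/
  einstein_eq : ∀ t, tᵢ < t → ∀ μ ν,
    einstein (structureCoeffs e) t μ ν = fluidStress γ ρ t μ ν + formStress J t μ ν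
  /-- `∇^μ T^{pf}_{μν} = 0` -/
  fluid_eq : ∀ t, tᵢ < t → ∀ ν,
    ∑ l, ∑ μ, eta l μ * covDerivTensor (structureCoeffs e) (fluidStress γ ρ) t l μ ν = 0
  /-- `∇_{[μ} J_{ν]} = 0` -/
  form_closed : ∀ t, tᵢ < t → ∀ μ ν,
    covDerivForm (structureCoeffs e) J t μ ν = covDerivForm (structureCoeffs e) J t ν μ
  /-- `∇_μ J^μ = 0` -/
  form_coclosed : ∀ t, tᵢ < t →
    ∑ μ, ∑ ν, eta μ ν * covDerivForm (structureCoeffs e) J t μ ν = 0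

namespace JFormSpacetime

variable {𝔤 : Type*} [LieRing 𝔤] [LieAlgebra ℝ 𝔤] {γ tᵢ : ℝ}

/-- Hubble parameter: one third of the expansion `∇_μ u^μ` of `u = ∂/∂t`. -/
def hubble (S : JFormSpacetime 𝔤 γ tᵢ) (t : ℝ) : ℝ :=
  (∑ μ, christoffel (structureCoeffs S.e) t μ μ 0) / 3

/-- Deceleration parameter, determined by `dH/dt = -(1 + q) H²` where `H ≠ 0`. -/
def decel (S : JFormSpacetime 𝔤 γ tᵢ) (t : ℝ) : ℝ :=
  -1 - deriv S.hubble t / S.hubble t ^ 2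

/-- Shear `σ_{ab} = ∇_a u_b - H δ_{ab}` (the congruence `∂/∂t` is irrotational). -/
def shear (S : JFormSpacetime 𝔤 γ tᵢ) (t : ℝ) (a b : Fin 3) : ℝ :=
  christoffel (structureCoeffs S.e) t b.succ a.succ 0 - if a = b then S.hubble t else 0

/-- Expansion-normalized energy density `Ω_pf = ρ / (3 H²)` of the perfect fluid. -/
def omegaFluid (S : JFormSpacetime 𝔤 γ tᵢ) (t : ℝ) : ℝ := S.ρ t / (3 * S.hubble t ^ 2)

/-- The space-time is asymptotic, as `t → ∞`, to the spatially flat isotropic perfect-fluid model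
with deceleration parameter `q₀ < 0`: the expansion-normalized shear, spatial structure coefficients
and `j`-form decay, the fluid dominates (`Ω_pf → 1`), and `q → q₀`. -/
structure AsymptoticallyQuasiDeSitter (S : JFormSpacetime 𝔤 γ tᵢ) (q₀ : ℝ) : Prop where
  accelerating : q₀ < 0
  expanding : ∀ᶠ t in atTop, 0 < S.hubble t
  tendsto_decel : Tendsto S.decel atTop (𝓝 q₀)
  tendsto_omegaFluid : Tendsto S.omegaFluid atTop (𝓝 1)
  tendsto_shear : ∀ a b, Tendsto (fun t => S.shear t a b / S.hubble t) atTop (𝓝 0)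
  tendsto_structure : ∀ a b c,
    Tendsto (fun t => (S.e t).repr ⁅S.e t b, S.e t c⁆ a / S.hubble t) atTop (𝓝 0)
  tendsto_form : ∀ μ, Tendsto (fun t => S.J t μ / S.hubble t) atTop (𝓝 0)

end JFormSpacetime

end Bianchi

end

namespace Bianchi

/-! ### Curvature of a homogeneous orthonormal tetrad -/

/-! Everything follows from three scalar equations and one sign. Write `σ²` and `J²` for the sums of
squares of all components. The `00` Einstein equation is `3H² = ρ + J²/2 + σ²/2 - R₃/2`, with `R₃`
the scalar curvature of the spatial sections (`friedmann`). The trace-reversed `00` equation gives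
`H' = -H² - σ²/3 + (2 - 3γ)ρ/6 - J₀²/3` (`hasDerivAt_hubble`), and fluid conservation gives `ρ' =
-3γHρ`. Solvability enters through `R₃ ≤ 0` (`spatialCurv_nonpos`), which makes every term on the
right of the Friedmann equation nonnegative.

Since `0 < ρ ≤ 3H²`, `H` cannot reach zero. The same bound gives `H' ≥ -3H²`, which forces `τ → ∞`.
The ratio `Z = (3H² - ρ)/ρ` of everything else to the fluid then obeys `Z' ≤ -(2 - 3γ)HZ`, so it
decays exponentially in `τ` (`tendsto_excess`). As `Z` dominates shear and form, these vanish
relative to `H`, and the limits of `Ω_pf` and `q` follow.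

The structure coefficients need a separate argument: the decay of `R₃/H²` does not control them,
since non-abelian groups (type VII₀) can carry flat metrics. Their squared norm satisfies `W' ≈
-2HW` once the shear is small, while `(H²)' = -2(1+q)H·H²` with `q` near `3γ/2 - 1 < 0`, so `W/H²`
also decays exponentially in `τ` (`tendsto_structConst_div_hubble`). -/

lemma sum_eta_mul (ρ : Fin 4) (f : Fin 4 → ℝ) :
    ∑ l, eta ρ l * f l = (if ρ = 0 then -1 else 1) * f ρ := by
  simp [eta]

/-- Structure coefficients of a tetrad `e_0 = ∂/∂t`, `e_a`, built from the coefficients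
`M^a_c` of `[e_0, e_c]` and `C^a_{bc}` of `[e_b, e_c]`. -/
noncomputable def tetradCoeffs (M : ℝ → Fin 3 → Fin 3 → ℝ) (C : ℝ → Fin 3 → Fin 3 → Fin 3 → ℝ) :
    StructureCoeffs := fun t ρ μ ν =>
  Fin.cases 0 (fun a =>
    Fin.cases
      (Fin.cases 0 (fun c => M t a c) ν)
      (fun b => Fin.cases (-M t a b)
        (fun c => C t a b c) ν) μ) ρ

section tetrad

variable (M : ℝ → Fin 3 → Fin 3 → ℝ) (C : ℝ → Fin 3 → Fin 3 → Fin 3 → ℝ) (t : ℝ) (a b c : Fin 3)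

@[simp] lemma tetradCoeffs_zero (μ ν : Fin 4) : tetradCoeffs M C t 0 μ ν = 0 := rfl
@[simp] lemma tetradCoeffs_succ_zero_zero : tetradCoeffs M C t a.succ 0 0 = 0 := rfl
@[simp] lemma tetradCoeffs_succ_zero_succ : tetradCoeffs M C t a.succ 0 c.succ = M t a c := rfl
@[simp] lemma tetradCoeffs_succ_succ_zero : tetradCoeffs M C t a.succ b.succ 0 = -M t a b := rfl
@[simp] lemma tetradCoeffs_succ_succ_succ :
    tetradCoeffs M C t a.succ b.succ c.succ = C t a b c := rfl

@[simp] lemma lowered_tetrad_zero (μ ν : Fin 4) : lowered (tetradCoeffs M C) t 0 μ ν = 0 := by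
  simp [lowered, sum_eta_mul]

@[simp] lemma lowered_tetrad_succ (μ ν : Fin 4) :
    lowered (tetradCoeffs M C) t a.succ μ ν = tetradCoeffs M C t a.succ μ ν := by
  simp [lowered, sum_eta_mul, Fin.succ_ne_zero]

lemma christoffel_zero (c : StructureCoeffs) (μ ν : Fin 4) : christoffel c t 0 μ ν =
    -((lowered c t 0 μ ν - lowered c t μ ν 0 + lowered c t ν 0 μ) / 2) := by
  simp [christoffel, sum_eta_mul]

lemma christoffel_succ (c : StructureCoeffs) (μ ν : Fin 4) : christoffel c t a.succ μ ν =
    (lowered c t a.succ μ ν - lowered c t μ ν a.succ + lowered c t ν a.succ μ) / 2 := by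
  simp [christoffel, sum_eta_mul, Fin.succ_ne_zero]

@[simp] lemma christoffel_tetrad_zero_zero (μ : Fin 4) :
    christoffel (tetradCoeffs M C) t 0 0 μ = 0 := by
  rw [christoffel_zero]
  cases μ using Fin.cases <;> simp

@[simp] lemma christoffel_tetrad_zero_right (μ : Fin 4) :
    christoffel (tetradCoeffs M C) t 0 μ 0 = 0 := by
  rw [christoffel_zero]
  cases μ using Fin.cases <;> simp

@[simp] lemma christoffel_tetrad_zero_succ_succ :
    christoffel (tetradCoeffs M C) t 0 b.succ c.succ = -(M t b c + M t c b) / 2 := by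
  rw [christoffel_zero]
  simp
  ring

@[simp] lemma christoffel_tetrad_succ_zero_zero :
    christoffel (tetradCoeffs M C) t a.succ 0 0 = 0 := by
  rw [christoffel_succ]
  simp

@[simp] lemma christoffel_tetrad_succ_zero_succ :
    christoffel (tetradCoeffs M C) t a.succ 0 b.succ = (M t a b - M t b a) / 2 := by
  rw [christoffel_succ]
  simp
  ring

@[simp] lemma christoffel_tetrad_succ_succ_zero :
    christoffel (tetradCoeffs M C) t a.succ b.succ 0 = -(M t a b + M t b a) / 2 := by
  rw [christoffel_succ]
  simp
  ring

@[simp] lemma christoffel_tetrad_succ_succ_succ :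
    christoffel (tetradCoeffs M C) t a.succ b.succ c.succ =
      (C t a b c - C t b c a + C t c a b) / 2 := by
  rw [christoffel_succ]
  simp

/-- Scalar curvature of the spatial sections in terms of the structure constants `C^a_{bc}` of an
orthonormal frame. -/
noncomputable def spatialCurv (C : Fin 3 → Fin 3 → Fin 3 → ℝ) : ℝ :=
  -(∑ a, ∑ b, ∑ c, C a b c ^ 2) / 4 - (∑ a, ∑ b, ∑ c, C a b c * C b a c) / 2
    - ∑ b, (∑ a, C a a b) ^ 2

/-- The Raychaudhuri equation: minus the symmetric part of `M` is the expansion tensor. The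
antisymmetric part is a rotation of the frame and drops out. -/
lemma ricci_tetrad_zero_zero : ricci (tetradCoeffs M C) t 0 0 =
    -(∑ a, deriv (fun s => -M s a a) t) - ∑ a, ∑ b, ((M t a b + M t b a) / 2) ^ 2 := by
  have h : ∀ a : Fin 3, (fun s => -(M s a a + M s a a) / 2) = fun s => -M s a a := by
    intro a; funext s; ring
  rw [ricci, Fin.sum_univ_succ]
  simp only [riemann, Fin.sum_univ_succ (n := 3), christoffel_tetrad_zero_zero,
    christoffel_tetrad_zero_right, christoffel_tetrad_succ_zero_zero,
    christoffel_tetrad_succ_zero_succ, christoffel_tetrad_succ_succ_zero,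
    tetradCoeffs_zero, tetradCoeffs_succ_zero_zero, tetradCoeffs_succ_succ_zero, frameDeriv,
    Fin.succ_ne_zero, if_true, if_false, h]
  simp only [Fin.sum_univ_three]
  simp
  ring

/-- The derivative of the expansion occurs with the sign opposite to that in `R₀₀`, so it cancels in
`G₀₀`, which becomes a constraint. -/
lemma sum_ricci_tetrad_succ (hC : ∀ t a b c, C t a b c = -C t a c b) :
    ∑ a : Fin 3, ricci (tetradCoeffs M C) t a.succ a.succ =
    ∑ a, deriv (fun s => -M s a a) t + (∑ a, M t a a) ^ 2 + spatialCurv (C t) := by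
  have h : ∀ a : Fin 3, (fun s => -(M s a a + M s a a) / 2) = fun s => -M s a a := by
    intro a; funext s; ring
  have h0 : ∀ a b, C t a b b = 0 := fun a b => by linarith [hC t a b b]
  have h1 := fun a => hC t a 1 0
  have h2 := fun a => hC t a 2 0
  have h3 := fun a => hC t a 2 1
  simp only [ricci, Fin.sum_univ_succ (n := 3), riemann, christoffel_tetrad_zero_zero,
    christoffel_tetrad_zero_right,
    christoffel_tetrad_zero_succ_succ, christoffel_tetrad_succ_succ_succ,
    christoffel_tetrad_succ_zero_succ, christoffel_tetrad_succ_succ_zero,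
    tetradCoeffs_zero, tetradCoeffs_succ_zero_succ, tetradCoeffs_succ_succ_succ, frameDeriv,
    Fin.succ_ne_zero, if_true, if_false, h, spatialCurv]
  simp only [Fin.sum_univ_three]
  simp only [h0, h1, h2, h3]
  ring

lemma scalarCurv_eq (c : StructureCoeffs) : scalarCurv c t =
    -ricci c t 0 0 + ∑ a : Fin 3, ricci c t a.succ a.succ := by
  simp only [scalarCurv, sum_eta_mul]
  simp only [Fin.sum_univ_succ (n := 3), Fin.succ_ne_zero, if_true, if_false, neg_mul, one_mul]

lemma einstein_zero_zero (c : StructureCoeffs) : einstein c t 0 0 =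
    (ricci c t 0 0 + ∑ a : Fin 3, ricci c t a.succ a.succ) / 2 := by
  rw [einstein, scalarCurv_eq]
  simp [eta]
  ring

lemma sum_einstein_succ (c : StructureCoeffs) : ∑ a : Fin 3, einstein c t a.succ a.succ =
    3 / 2 * ricci c t 0 0 - (∑ a : Fin 3, ricci c t a.succ a.succ) / 2 := by
  simp only [einstein, scalarCurv_eq]
  simp [eta, Fin.sum_univ_three]
  ring

end tetrad

/-- The scalar curvature of a left-invariant metric is nonpositive as soon as the derived algebra
is annihilated by a nonzero linear form. -/
lemma spatialCurv_nonpos {C : Fin 3 → Fin 3 → Fin 3 → ℝ} (hC : ∀ a b c, C a b c = -C a c b)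
    {φ : Fin 3 → ℝ} (hφ : φ ≠ 0) (h : ∀ b c, ∑ a, φ a * C a b c = 0) : spatialCurv C ≤ 0 := by
  have h0 : ∀ a b, C a b b = 0 := fun a b => by linarith [hC a b b]
  set n := φ 0 ^ 2 + φ 1 ^ 2 + φ 2 ^ 2 with hn
  have hpos : 0 < n := by
    have : ∃ i, φ i ≠ 0 := by
      by_contra! hcon
      exact hφ (funext hcon)
    obtain ⟨i, hi⟩ := this
    have := pow_pos (abs_pos.2 hi) 2
    rw [sq_abs] at this
    fin_cases i <;> simp at this <;> nlinarith [sq_nonneg (φ 0), sq_nonneg (φ 1), sq_nonneg (φ 2)]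
  -- the columns of `C` are orthogonal to `φ`, hence of the form `φ × V`
  have key : ∀ b c, ∃ x y z : ℝ, C 0 b c = φ 1 * z - φ 2 * y ∧ C 1 b c = φ 2 * x - φ 0 * z ∧
      C 2 b c = φ 0 * y - φ 1 * x := by
    intro b c
    have := h b c
    rw [Fin.sum_univ_three] at this
    -- The witness is `V = (C × φ)/n`, because `φ × (C × φ) = nC` when `φ · C = 0`.
    refine ⟨(C 1 b c * φ 2 - C 2 b c * φ 1) / n, (C 2 b c * φ 0 - C 0 b c * φ 2) / n,
      (C 0 b c * φ 1 - C 1 b c * φ 0) / n, ?_, ?_, ?_⟩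
    · field_simp
      rw [hn]
      linear_combination φ 0 * this
    · field_simp
      rw [hn]
      linear_combination φ 1 * this
    · field_simp
      rw [hn]
      linear_combination φ 2 * this
  obtain ⟨x₁, y₁, z₁, p₁, q₁, r₁⟩ := key 1 2
  obtain ⟨x₂, y₂, z₂, p₂, q₂, r₂⟩ := key 2 0
  obtain ⟨x₃, y₃, z₃, p₃, q₃, r₃⟩ := key 0 1
  -- For unit `φ` this is minus a sum of squares: the symmetric part of `ad φ`, its trace, and the
  -- bracket of an orthonormal basis of the plane `φ^⊥`, which contains the derived algebra.
  have id : n * spatialCurv C =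
      -(∑ a, ∑ b, (∑ d, φ d * (C a d b + C b d a)) ^ 2) / 4 - (∑ d, φ d * ∑ a, C a d a) ^ 2
        - 2 * ∑ a, (φ 0 * C a 1 2 + φ 1 * C a 2 0 + φ 2 * C a 0 1) ^ 2 := by
    simp only [spatialCurv, Fin.sum_univ_three, h0, hC _ 1 0, hC _ 0 2, hC _ 2 1, p₁, q₁, r₁,
      p₂, q₂, r₂, p₃, q₃, r₃, hn]
    ring
  have : n * spatialCurv C ≤ 0 := by
    rw [id]
    have h1 : 0 ≤ ∑ a, ∑ b, (∑ d, φ d * (C a d b + C b d a)) ^ 2 :=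
      Finset.sum_nonneg fun _ _ => Finset.sum_nonneg fun _ _ => sq_nonneg _
    have h2 : 0 ≤ ∑ a, (φ 0 * C a 1 2 + φ 1 * C a 2 0 + φ 2 * C a 0 1) ^ 2 :=
      Finset.sum_nonneg fun _ _ => sq_nonneg _
    nlinarith [sq_nonneg (∑ d, φ d * ∑ a, C a d a)]
  by_contra! hcon
  nlinarith [mul_pos hpos hcon]

/-! ### Kinematics of a time-dependent frame -/

section frame

variable {𝔤 : Type*} [LieRing 𝔤] [LieAlgebra ℝ 𝔤] (e : ℝ → Module.Basis (Fin 3) ℝ 𝔤)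

/-- The coefficients `M^a_c` of `d e_c / dt = M^a_c e_a`. -/
noncomputable def frameRate (t : ℝ) (a c : Fin 3) : ℝ := deriv (fun s => (e t).repr (e s c) a) t

/-- The spatial structure coefficients `C^a_{bc}`. -/
noncomputable def structConst (t : ℝ) (a b c : Fin 3) : ℝ := (e t).repr ⁅e t b, e t c⁆ a

lemma structureCoeffs_eq : structureCoeffs e = tetradCoeffs (frameRate e) (structConst e) := rfl

lemma structConst_antisymm (t : ℝ) (a b c : Fin 3) :
    structConst e t a b c = -structConst e t a c b := by
  rw [structConst, structConst, ← lie_skew, map_neg, Finsupp.neg_apply]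

lemma repr_eq_sum_repr (s t : ℝ) (x : 𝔤) (a : Fin 3) :
    (e s).repr x a = ∑ d, (e s).repr (e t d) a * (e t).repr x d := by
  conv_lhs => rw [← (e t).sum_repr x]
  simp only [map_sum, map_smul, Finsupp.coe_finsetSum, Finset.sum_apply, Finsupp.smul_apply,
    smul_eq_mul]
  exact Finset.sum_congr rfl fun d _ => mul_comm _ _

/-- With the reference frame at `t` held fixed, all dependence on `s` sits in the two transition
matrices, so differentiation in `s` becomes the product rule. -/
lemma structConst_eq_sum (s t : ℝ) (a b c : Fin 3) :
    structConst e s a b c = ∑ d, (e s).repr (e t d) a *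
      ∑ p, ∑ q, (e t).repr (e s b) p * (e t).repr (e s c) q * structConst e t d p q := by
  rw [structConst, repr_eq_sum_repr e s t]
  refine Finset.sum_congr rfl fun d _ => ?_
  congr 1
  conv_lhs => rw [← (e t).sum_repr (e s b), ← (e t).sum_repr (e s c)]
  simp only [sum_lie, lie_sum, smul_lie, lie_smul, map_sum, map_smul,
    Finsupp.coe_finsetSum, Finset.sum_apply, Finsupp.smul_apply, smul_eq_mul, structConst, Finset.mul_sum]
  rw [Finset.sum_comm]
  exact Finset.sum_congr rfl fun p _ => Finset.sum_congr rfl fun q _ => by ring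

variable {e} {tᵢ : ℝ}

lemma contDiffOn_repr
    (he : ∀ (φ : Module.Dual ℝ 𝔤) (a : Fin 3), ContDiffOn ℝ 2 (fun t => φ (e t a)) (Ioi tᵢ))
    (t : ℝ) (a c : Fin 3) : ContDiffOn ℝ 2 (fun s => (e t).repr (e s c) a) (Ioi tᵢ) :=
  he ((e t).coord a) c

lemma differentiableAt_repr
    (he : ∀ (φ : Module.Dual ℝ 𝔤) (a : Fin 3), ContDiffOn ℝ 2 (fun t => φ (e t a)) (Ioi tᵢ))
    (t : ℝ) {s : ℝ} (hs : tᵢ < s) (a c : Fin 3) :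
    DifferentiableAt ℝ (fun s => (e t).repr (e s c) a) s :=
  ((contDiffOn_repr he t a c).differentiableOn (by norm_num)).differentiableAt (Ioi_mem_nhds hs)

/-- This transition matrix is the inverse of a differentiable one, and Cramer's rule makes its
entries rational in differentiable functions. -/
lemma differentiableAt_repr_left
    (he : ∀ (φ : Module.Dual ℝ 𝔤) (a : Fin 3), ContDiffOn ℝ 2 (fun t => φ (e t a)) (Ioi tᵢ))
    (t : ℝ) {s : ℝ} (hs : tᵢ < s) (a d : Fin 3) :
    DifferentiableAt ℝ (fun s => (e s).repr (e t d) a) s := by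
  have hP := fun a c => differentiableAt_repr he t hs a c
  have hmul : ∀ s, (e s).toMatrix (e t) * (e t).toMatrix (e s) = 1 := fun s =>
    (e s).toMatrix_mul_toMatrix_flip (e t)
  have hinv : ∀ s, (e s).repr (e t d) a =
      (((e t).toMatrix (e s)).det)⁻¹ * ((e t).toMatrix (e s)).adjugate a d := by
    intro s
    have : (e s).toMatrix (e t) a d = ((e t).toMatrix (e s))⁻¹ a d := by
      rw [Matrix.inv_eq_left_inv (hmul s)]
    rw [Module.Basis.toMatrix_apply] at this
    rw [this, Matrix.inv_def, Matrix.smul_apply, Ring.inverse_eq_inv', smul_eq_mul]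
  have hdet : ((e t).toMatrix (e s)).det ≠ 0 := by
    intro h
    have := congrArg Matrix.det (hmul s)
    rw [Matrix.det_mul, h, Matrix.det_one, mul_zero] at this
    exact zero_ne_one this
  simp only [hinv]
  refine DifferentiableAt.mul (DifferentiableAt.inv ?_ hdet) ?_
  · simp only [Matrix.det_fin_three, Module.Basis.toMatrix_apply]
    fun_prop
  · simp only [Matrix.adjugate_fin_three, Module.Basis.toMatrix_apply]
    fin_cases a <;> fin_cases d <;> simp <;> fun_prop

lemma hasDerivAt_repr
    (he : ∀ (φ : Module.Dual ℝ 𝔤) (a : Fin 3), ContDiffOn ℝ 2 (fun t => φ (e t a)) (Ioi tᵢ))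
    {t : ℝ} (ht : tᵢ < t) (a c : Fin 3) :
    HasDerivAt (fun s => (e t).repr (e s c) a) (frameRate e t a c) t :=
  (differentiableAt_repr he t ht a c).hasDerivAt

lemma repr_self_apply' (t : ℝ) (a c : Fin 3) : (e t).repr (e t c) a = if c = a then 1 else 0 := by
  rw [Module.Basis.repr_self, Finsupp.single_apply]

/-- Obtained by differentiating `P⁻¹P = 1` at the time where both factors are the identity. -/
lemma hasDerivAt_repr_left
    (he : ∀ (φ : Module.Dual ℝ 𝔤) (a : Fin 3), ContDiffOn ℝ 2 (fun t => φ (e t a)) (Ioi tᵢ))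
    {t : ℝ} (ht : tᵢ < t) (a c : Fin 3) :
    HasDerivAt (fun s => (e s).repr (e t c) a) (-frameRate e t a c) t := by
  have hQ := fun d => (differentiableAt_repr_left he t ht a d).hasDerivAt
  have hsum := HasDerivAt.fun_sum (u := Finset.univ)
    fun d _ => (hQ d).mul (hasDerivAt_repr he ht d c)
  have hconst : (fun s => ∑ d, (e s).repr (e t d) a * (e t).repr (e s c) d) =
      fun _ => if c = a then (1 : ℝ) else 0 := by
    funext s
    rw [← repr_eq_sum_repr, repr_self_apply']
  have h0 := hsum.unique ((hasDerivAt_const t (if c = a then (1 : ℝ) else 0)).congr_of_eventuallyEq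
    (Eventually.of_forall fun s => congrFun hconst s))
  simp only [repr_self_apply', mul_ite, ite_mul, mul_one, mul_zero, one_mul, zero_mul,
    Finset.sum_add_distrib, Finset.sum_ite_eq, Finset.sum_ite_eq', Finset.mem_univ, if_true] at h0
  have := hQ c
  rwa [eq_neg_of_add_eq_zero_left h0] at this

/-- In a fixed reference frame the rate is `P⁻¹P'`; a `C²` frame makes `P'` differentiable. -/
lemma differentiableAt_frameRate
    (he : ∀ (φ : Module.Dual ℝ 𝔤) (a : Fin 3), ContDiffOn ℝ 2 (fun t => φ (e t a)) (Ioi tᵢ))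
    {t : ℝ} (ht : tᵢ < t) (a c : Fin 3) :
    DifferentiableAt ℝ (fun s => frameRate e s a c) t := by
  have heq : (fun s => frameRate e s a c) =ᶠ[𝓝 t]
      fun s => ∑ d, (e s).repr (e t d) a * deriv (fun r => (e t).repr (e r c) d) s := by
    filter_upwards [Ioi_mem_nhds ht] with s hs
    have : (fun r => (e s).repr (e r c) a) =
        fun r => ∑ d, (e s).repr (e t d) a * (e t).repr (e r c) d :=
      funext fun r => repr_eq_sum_repr e s t _ a
    rw [frameRate, this]
    exact (HasDerivAt.fun_sum fun d _ =>
      (differentiableAt_repr he t hs d c).hasDerivAt.const_mul _).deriv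
  refine DifferentiableAt.congr_of_eventuallyEq ?_ heq
  refine DifferentiableAt.fun_sum fun d _ => (differentiableAt_repr_left he t ht a d).mul ?_
  have h1 : ContDiffOn ℝ 1 (deriv fun r => (e t).repr (e r c) d) (Ioi tᵢ) :=
    (contDiffOn_repr he t d c).deriv_of_isOpen isOpen_Ioi (by norm_num)
  exact (h1.differentiableOn (by norm_num)).differentiableAt (Ioi_mem_nhds ht)

/-- The bracket of `𝔤` is fixed and only the frame moves: each lower index contributes `+M` and the
upper index `-M`. -/
lemma hasDerivAt_structConst
    (he : ∀ (φ : Module.Dual ℝ 𝔤) (a : Fin 3), ContDiffOn ℝ 2 (fun t => φ (e t a)) (Ioi tᵢ))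
    {t : ℝ} (ht : tᵢ < t) (a b c : Fin 3) :
    HasDerivAt (fun s => structConst e s a b c)
      (∑ d, frameRate e t d b * structConst e t a d c
        + ∑ d, frameRate e t d c * structConst e t a b d
        - ∑ d, frameRate e t a d * structConst e t d b c) t := by
  have h := HasDerivAt.fun_sum (u := Finset.univ) fun d _ =>
    (hasDerivAt_repr_left he ht a d).mul <| HasDerivAt.fun_sum (u := Finset.univ) fun p _ =>
      HasDerivAt.fun_sum (u := Finset.univ) fun q _ =>
        ((hasDerivAt_repr he ht p b).mul (hasDerivAt_repr he ht q c)).mul_const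
          (structConst e t d p q)
  simp only [structConst_eq_sum e _ t a b c]
  refine h.congr_deriv ?_
  simp only [Pi.mul_apply, repr_self_apply', mul_ite, ite_mul, mul_one, mul_zero, one_mul, zero_mul, add_mul,
    Finset.sum_add_distrib, Finset.sum_ite_eq, Finset.sum_ite_eq', Finset.mem_univ, if_true,
    neg_mul, Finset.sum_neg_distrib, Finset.sum_ite_irrel, Finset.sum_const_zero]
  ring

/-- A nonzero solvable algebra has a proper derived ideal, and a proper subspace lies in the kernel
of a nonzero functional. -/
lemma exists_form_annihilating_brackets [LieAlgebra.IsSolvable 𝔤] (b : Module.Basis (Fin 3) ℝ 𝔤) :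
    ∃ φ : Fin 3 → ℝ, φ ≠ 0 ∧ ∀ x y : 𝔤, ∑ a, φ a * b.repr ⁅x, y⁆ a = 0 := by
  have : Nontrivial 𝔤 := ⟨b 0, b 1, fun h => by simpa using b.injective h⟩
  have hlt := LieAlgebra.derivedSeries_lt_top_of_solvable ℝ 𝔤
  have hlt' : (LieAlgebra.derivedSeries ℝ 𝔤 1).toSubmodule < ⊤ := by
    rw [lt_top_iff_ne_top] at hlt ⊢
    intro h
    exact hlt (by simpa using h)
  obtain ⟨f, hf, hker⟩ := Submodule.exists_le_ker_of_lt_top _ hlt'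
  refine ⟨fun a => f (b a), fun h => hf (b.ext fun a => congrFun h a), fun x y => ?_⟩
  have hmem : ⁅x, y⁆ ∈ (LieAlgebra.derivedSeries ℝ 𝔤 1).toSubmodule :=
    LieSubmodule.lie_mem_lie (LieSubmodule.mem_top x) (LieSubmodule.mem_top y)
  have h0 : f ⁅x, y⁆ = 0 := hker hmem
  rw [← b.sum_repr ⁅x, y⁆, map_sum] at h0
  rw [← h0]
  exact Finset.sum_congr rfl fun a _ => by rw [map_smul, smul_eq_mul, mul_comm]

lemma spatialCurv_structConst_nonpos [LieAlgebra.IsSolvable 𝔤] (t : ℝ) :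
    spatialCurv (structConst e t) ≤ 0 := by
  obtain ⟨φ, hφ, h⟩ := exists_form_annihilating_brackets (e t)
  exact spatialCurv_nonpos (structConst_antisymm e t) hφ fun b c => h _ _

end frame

/-! ### Einstein's equations in terms of expansion, shear and spatial curvature -/

lemma fluidStress_zero_zero (γ : ℝ) (ρ : ℝ → ℝ) (t : ℝ) : fluidStress γ ρ t 0 0 = ρ t := by
  simp [fluidStress, fourVelocity, eta]

lemma fluidStress_succ_zero (γ : ℝ) (ρ : ℝ → ℝ) (t : ℝ) (a : Fin 3) :
    fluidStress γ ρ t a.succ 0 = 0 := by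
  simp [fluidStress, fourVelocity, eta]

lemma fluidStress_succ_succ (γ : ℝ) (ρ : ℝ → ℝ) (t : ℝ) (a b : Fin 3) :
    fluidStress γ ρ t a.succ b.succ = if a = b then (γ - 1) * ρ t else 0 := by
  simp [fluidStress, fourVelocity, eta]

lemma formStress_zero_zero (J : ℝ → Fin 4 → ℝ) (t : ℝ) :
    formStress J t 0 0 = (∑ μ, J t μ ^ 2) / 2 := by
  simp only [formStress, mul_assoc, sum_eta_mul]
  simp [eta, Fin.sum_univ_succ]
  ring

lemma sum_formStress_succ (J : ℝ → Fin 4 → ℝ) (t : ℝ) :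
    ∑ a : Fin 3, formStress J t a.succ a.succ = 2 * J t 0 ^ 2 - (∑ μ, J t μ ^ 2) / 2 := by
  simp only [formStress, mul_assoc, sum_eta_mul]
  simp [eta, Fin.sum_univ_succ]
  ring

namespace JFormSpacetime

variable {𝔤 : Type*} [LieRing 𝔤] [LieAlgebra ℝ 𝔤] {γ tᵢ : ℝ} (S : JFormSpacetime 𝔤 γ tᵢ) {t : ℝ}

lemma hubble_eq (t : ℝ) : S.hubble t = (∑ a, -frameRate S.e t a a) / 3 := by
  rw [hubble, structureCoeffs_eq, Fin.sum_univ_succ]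
  simp only [christoffel_tetrad_zero_zero, christoffel_tetrad_succ_succ_zero, zero_add]
  congr 1
  exact Finset.sum_congr rfl fun a _ => by ring

lemma shear_eq (t : ℝ) (a b : Fin 3) : S.shear t a b =
    -(frameRate S.e t a b + frameRate S.e t b a) / 2 - if a = b then S.hubble t else 0 := by
  rw [shear, structureCoeffs_eq, christoffel_tetrad_succ_succ_zero, add_comm]

/-- Trace reversal gives `R₀₀ = (T₀₀ + ∑ T_aa)/2`, in which the spatial components of `J` cancel. -/
lemma ricci_zero_zero (ht : tᵢ < t) : ricci (structureCoeffs S.e) t 0 0 =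
    (3 * γ - 2) / 2 * S.ρ t + S.J t 0 ^ 2 := by
  have h0 := S.einstein_eq t ht 0 0
  have h1 : ∑ a : Fin 3, einstein (structureCoeffs S.e) t a.succ a.succ =
      ∑ a : Fin 3, (fluidStress γ S.ρ t a.succ a.succ + formStress S.J t a.succ a.succ) :=
    Finset.sum_congr rfl fun a _ => S.einstein_eq t ht _ _
  rw [einstein_zero_zero, fluidStress_zero_zero, formStress_zero_zero] at h0
  rw [sum_einstein_succ, Finset.sum_add_distrib, sum_formStress_succ] at h1
  simp only [fluidStress_succ_succ, if_true, Finset.sum_const, Finset.card_univ, Fintype.card_fin,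
    nsmul_eq_mul] at h1
  push_cast at h1
  linarith

lemma friedmann (ht : tᵢ < t) : 3 * S.hubble t ^ 2 =
    S.ρ t + (∑ μ, S.J t μ ^ 2) / 2 + (∑ a, ∑ b, S.shear t a b ^ 2) / 2
      - spatialCurv (structConst S.e t) / 2 := by
  have h0 := S.einstein_eq t ht 0 0
  rw [einstein_zero_zero, fluidStress_zero_zero, formStress_zero_zero, structureCoeffs_eq,
    ricci_tetrad_zero_zero, sum_ricci_tetrad_succ _ _ _ (structConst_antisymm S.e)] at h0
  have hH := S.hubble_eq t
  simp only [shear_eq]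
  simp only [Fin.sum_univ_three] at h0 hH ⊢
  simp [-mul_eq_mul_left_iff]
  rw [hH]
  linarith

lemma hasDerivAt_hubble (ht : tᵢ < t) : HasDerivAt S.hubble
    (-S.hubble t ^ 2 - (∑ a, ∑ b, S.shear t a b ^ 2) / 3 - (3 * γ - 2) / 6 * S.ρ t
      - S.J t 0 ^ 2 / 3) t := by
  have h0 := S.ricci_zero_zero ht
  rw [structureCoeffs_eq, ricci_tetrad_zero_zero] at h0
  have hd := (HasDerivAt.fun_sum (u := Finset.univ) fun a _ =>
    (differentiableAt_frameRate S.contDiff_e ht a a).neg.hasDerivAt).div_const 3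
  refine (hd.congr_deriv ?_).congr_of_eventuallyEq (Eventually.of_forall S.hubble_eq)
  have hH := S.hubble_eq t
  simp only [shear_eq]
  simp only [Fin.sum_univ_three] at h0 hH ⊢
  simp [-mul_eq_mul_left_iff] at h0 ⊢
  rw [hH]
  linarith

lemma hasDerivAt_density (ht : tᵢ < t) :
    HasDerivAt S.ρ (-(3 * γ * S.hubble t * S.ρ t)) t := by
  have hd := (S.differentiable_ρ.differentiableAt (Ioi_mem_nhds ht)).hasDerivAt
  refine hd.congr_deriv ?_
  have h := S.fluid_eq t ht 0
  simp only [sum_eta_mul] at h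
  simp only [structureCoeffs_eq, covDerivTensor, Fin.sum_univ_succ (n := 3), frameDeriv,
    Fin.succ_ne_zero, if_true, if_false,
    christoffel_tetrad_zero_succ_succ, christoffel_tetrad_succ_succ_zero,
    christoffel_tetrad_zero_right, christoffel_tetrad_succ_zero_zero,
    fluidStress_zero_zero, fluidStress_succ_zero, fluidStress_succ_succ] at h
  rw [hubble_eq]
  simp [Fin.sum_univ_three] at h ⊢
  linarith

end JFormSpacetime

/-! ### Late-time behaviour -/

/-- Grönwall's argument in the time `τ`: `V e^{κτ}` is nonincreasing. -/
lemma tendsto_zero_of_deriv_le {V V' τ H : ℝ → ℝ} {κ T : ℝ} (hκ : 0 < κ)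
    (hV : ∀ t, T ≤ t → HasDerivAt V (V' t) t) (hτ : ∀ t, T ≤ t → HasDerivAt τ (H t) t)
    (hle : ∀ t, T ≤ t → V' t ≤ -(κ * H t * V t)) (h0 : ∀ t, T ≤ t → 0 ≤ V t)
    (hlim : Tendsto τ atTop atTop) : Tendsto V atTop (𝓝 0) := by
  have hd : ∀ t, T ≤ t → HasDerivAt (fun s => V s * Real.exp (κ * τ s))
      (V' t * Real.exp (κ * τ t) + V t * (Real.exp (κ * τ t) * (κ * H t))) t := fun t ht =>
    (hV t ht).mul ((hτ t ht).const_mul κ).exp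
  have hanti : AntitoneOn (fun s => V s * Real.exp (κ * τ s)) (Ici T) := by
    refine antitoneOn_of_deriv_nonpos (convex_Ici T)
      (fun t ht => (hd t ht).continuousAt.continuousWithinAt)
      (fun t ht => (hd t (interior_subset ht)).differentiableAt.differentiableWithinAt)
      fun t ht => ?_
    rw [(hd t (interior_subset ht)).deriv]
    have := hle t (interior_subset ht)
    nlinarith [Real.exp_pos (κ * τ t)]
  have hexp : Tendsto (fun t => V T * Real.exp (κ * τ T) * Real.exp (-(κ * τ t))) atTop (𝓝 0) := by
    have := (Real.tendsto_exp_neg_atTop_nhds_zero.comp (hlim.const_mul_atTop hκ)).const_mul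
      (V T * Real.exp (κ * τ T))
    simpa using this
  refine tendsto_of_tendsto_of_tendsto_of_le_of_le' tendsto_const_nhds hexp
    (eventually_ge_atTop T |>.mono h0) ?_
  filter_upwards [eventually_ge_atTop T] with t ht
  have := hanti (mem_Ici.2 le_rfl) (mem_Ici.2 ht) ht
  rw [Real.exp_neg, ← div_eq_mul_inv, le_div_iff₀ (Real.exp_pos _)]
  exact this

lemma tendsto_div_zero_of_sq_le {f H Z : ℝ → ℝ} {K : ℝ} (hZ : Tendsto Z atTop (𝓝 0))
    (h : ∀ᶠ t in atTop, 0 < H t ∧ f t ^ 2 ≤ K * Z t * H t ^ 2) :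
    Tendsto (fun t => f t / H t) atTop (𝓝 0) := by
  have hsq : Tendsto (fun t => (f t / H t) ^ 2) atTop (𝓝 0) := by
    refine tendsto_of_tendsto_of_tendsto_of_le_of_le' tendsto_const_nhds
      (by simpa using hZ.const_mul K) (Eventually.of_forall fun t => sq_nonneg _) ?_
    filter_upwards [h] with t ht
    rw [div_pow, div_le_iff₀ (pow_pos ht.1 2)]
    exact ht.2
  rw [tendsto_zero_iff_abs_tendsto_zero]
  have := hsq.sqrt
  simpa [Function.comp_def, Real.sqrt_sq_eq_abs] using this

/-- A quadratic form whose symmetric part is `-(H + σ)` with `|σ_{ab}| ≤ δ`. -/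
lemma abs_quadForm_add_le {M : Fin 3 → Fin 3 → ℝ} {σ : Fin 3 → Fin 3 → ℝ} {H δ : ℝ}
    (hM : ∀ a b, σ a b = -(M a b + M b a) / 2 - if a = b then H else 0)
    (hσ : ∀ a b, |σ a b| ≤ δ) (x : Fin 3 → ℝ) :
    |∑ b, ∑ d, M d b * x d * x b + H * ∑ b, x b ^ 2| ≤ 3 * δ * ∑ b, x b ^ 2 := by
  -- A quadratic form sees only the symmetric part of `M`.
  have heq : ∑ b, ∑ d, M d b * x d * x b + H * ∑ b, x b ^ 2 =
      -∑ b, ∑ d, σ b d * (x b * x d) := by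
    simp only [hM]
    simp [Fin.sum_univ_three]
    ring
  rw [heq, abs_neg]
  have hterm : ∀ b d, |σ b d * (x b * x d)| ≤ δ * ((x b ^ 2 + x d ^ 2) / 2) := by
    intro b d
    rw [abs_mul]
    refine mul_le_mul (hσ b d) ?_ (abs_nonneg _) ((abs_nonneg _).trans (hσ b d))
    rw [abs_le]
    constructor <;> nlinarith [sq_nonneg (x b + x d), sq_nonneg (x b - x d)]
  calc |∑ b, ∑ d, σ b d * (x b * x d)| ≤ ∑ b, ∑ d, |σ b d * (x b * x d)| :=
        (Finset.abs_sum_le_sum_abs _ _).trans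
          (Finset.sum_le_sum fun b _ => Finset.abs_sum_le_sum_abs _ _)
    _ ≤ ∑ b, ∑ d, δ * ((x b ^ 2 + x d ^ 2) / 2) :=
        Finset.sum_le_sum fun b _ => Finset.sum_le_sum fun d _ => hterm b d
    _ = 3 * δ * ∑ b, x b ^ 2 := by
        simp only [Fin.sum_univ_three]
        ring

/-- Growth estimate for the squared norm of the structure constants under a change of frame with
rate `M`. -/
lemma sum_structConst_rate_le {M : Fin 3 → Fin 3 → ℝ} {σ : Fin 3 → Fin 3 → ℝ} {H δ : ℝ}
    (hM : ∀ a b, σ a b = -(M a b + M b a) / 2 - if a = b then H else 0)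
    (hσ : ∀ a b, |σ a b| ≤ δ) (C : Fin 3 → Fin 3 → Fin 3 → ℝ) :
    ∑ a, ∑ b, ∑ c, 2 * C a b c * (∑ d, M d b * C a d c + ∑ d, M d c * C a b d
      - ∑ d, M a d * C d b c) ≤ (-2 * H + 18 * δ) * ∑ a, ∑ b, ∑ c, C a b c ^ 2 := by
  -- Each index slot of `C` is treated as a vector. The upper slot enters with the opposite sign,
  -- hence the lower bound in `h3`. The total is `2(-H - H + H) = -2H`, with error `2 · 3 · 3δ =
  -- 18δ`.
  have h1 : ∀ a c, _ := fun a c => (abs_le.1 (abs_quadForm_add_le hM hσ fun b => C a b c)).2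
  have h2 : ∀ a b, _ := fun a b => (abs_le.1 (abs_quadForm_add_le hM hσ fun c => C a b c)).2
  have h3 : ∀ b c, _ := fun b c => (abs_le.1 (abs_quadForm_add_le hM hσ fun a => C a b c)).1
  have s1 := Finset.sum_le_sum (s := Finset.univ) fun a _ =>
    Finset.sum_le_sum (s := Finset.univ) fun c _ => h1 a c
  have s2 := Finset.sum_le_sum (s := Finset.univ) fun a _ =>
    Finset.sum_le_sum (s := Finset.univ) fun c _ => h2 a c
  have s3 := Finset.sum_le_sum (s := Finset.univ) fun a _ =>
    Finset.sum_le_sum (s := Finset.univ) fun c _ => h3 a c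
  simp only [Fin.sum_univ_three] at s1 s2 s3 ⊢
  linarith

/-! ### Persistence of expansion, divergence of `τ`, and decay of the normalized variables. -/

namespace JFormSpacetime

variable {𝔤 : Type*} [LieRing 𝔤] [LieAlgebra ℝ 𝔤] {γ tᵢ : ℝ} (S : JFormSpacetime 𝔤 γ tᵢ)
  {t t₀ : ℝ}

lemma continuousOn_hubble : ContinuousOn S.hubble (Ioi tᵢ) := fun _ ht =>
  (S.hasDerivAt_hubble ht).continuousAt.continuousWithinAt

/-- The dimensionless time `τ` with `dτ = H dt`. -/
lemma hasDerivAt_integral_hubble (ht₀ : tᵢ < t₀) (ht : tᵢ < t) :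
    HasDerivAt (fun t => ∫ s in t₀..t, S.hubble s) (S.hubble t) t := by
  have hsub : uIcc t₀ t ⊆ Ioi tᵢ := fun x hx => lt_of_lt_of_le (lt_min ht₀ ht) hx.1
  exact intervalIntegral.integral_hasDerivAt_right
    (S.continuousOn_hubble.mono hsub).intervalIntegrable
    (S.continuousOn_hubble.stronglyMeasurableAtFilter isOpen_Ioi t ht)
    (S.hasDerivAt_hubble ht).continuousAt

lemma density_pos (ht₀ : tᵢ < t₀) (hρ : 0 < S.ρ t₀) (ht : t₀ ≤ t) : 0 < S.ρ t := by
  set τ := fun t => ∫ s in t₀..t, S.hubble s with hτ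
  -- `ρ e^{3γτ}` is conserved, so `ρ` keeps its sign whatever the sign of `H`.
  have hd : ∀ s, t₀ ≤ s → HasDerivAt (fun s => S.ρ s * Real.exp (3 * γ * τ s)) 0 s := by
    intro s hs
    have hs' := ht₀.trans_le hs
    refine ((S.hasDerivAt_density hs').mul
      ((S.hasDerivAt_integral_hubble ht₀ hs').const_mul (3 * γ)).exp).congr_deriv ?_
    ring
  have hconst := constant_of_has_deriv_right_zero (a := t₀) (b := t)
    (fun s hs => (hd s hs.1).continuousAt.continuousWithinAt)
    (fun s hs => (hd s hs.1).hasDerivWithinAt) t ⟨ht, le_rfl⟩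
  have : 0 < S.ρ t * Real.exp (3 * γ * τ t) := by
    rw [hconst]
    exact mul_pos hρ (Real.exp_pos _)
  exact pos_of_mul_pos_left this (Real.exp_pos _).le

lemma sum_shear_sq_nonneg (t : ℝ) : 0 ≤ ∑ a, ∑ b, S.shear t a b ^ 2 :=
  Finset.sum_nonneg fun _ _ => Finset.sum_nonneg fun _ _ => sq_nonneg _

lemma sq_form_le_sum (t : ℝ) (μ : Fin 4) : S.J t μ ^ 2 ≤ ∑ μ, S.J t μ ^ 2 :=
  Finset.single_le_sum (f := fun μ => S.J t μ ^ 2) (fun _ _ => sq_nonneg _) (Finset.mem_univ μ)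

lemma sq_shear_le_sum (t : ℝ) (a b : Fin 3) : S.shear t a b ^ 2 ≤ ∑ a, ∑ b, S.shear t a b ^ 2 :=
  (Finset.single_le_sum (f := fun b => S.shear t a b ^ 2) (fun _ _ => sq_nonneg _)
    (Finset.mem_univ b)).trans
  (Finset.single_le_sum (f := fun a => ∑ b, S.shear t a b ^ 2)
    (fun _ _ => Finset.sum_nonneg fun _ _ => sq_nonneg _) (Finset.mem_univ a))

variable [LieAlgebra.IsSolvable 𝔤]

/-- The Friedmann equation with the nonnegative term `-R₃/2` discarded. -/
lemma shear_add_form_le (ht : tᵢ < t) :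
    ∑ μ, S.J t μ ^ 2 + ∑ a, ∑ b, S.shear t a b ^ 2 ≤ 2 * (3 * S.hubble t ^ 2 - S.ρ t) := by
  linarith [S.friedmann ht, spatialCurv_structConst_nonpos (e := S.e) t]

lemma density_le (ht : tᵢ < t) : S.ρ t ≤ 3 * S.hubble t ^ 2 := by
  linarith [S.shear_add_form_le ht, S.sum_shear_sq_nonneg t, S.sq_form_le_sum t 0,
    sq_nonneg (S.J t 0)]

lemma hubble_pos (ht₀ : tᵢ < t₀) (hH : 0 < S.hubble t₀) (hρ : 0 < S.ρ t₀) (ht : t₀ ≤ t) :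
    0 < S.hubble t := by
  by_contra! hneg
  have hcont : ContinuousOn S.hubble (Icc t₀ t) :=
    S.continuousOn_hubble.mono fun x hx => ht₀.trans_le hx.1
  obtain ⟨s, hs, h0⟩ := intermediate_value_Icc' ht hcont ⟨hneg, hH.le⟩
  have h1 := S.density_le (ht₀.trans_le hs.1)
  have h2 := S.density_pos ht₀ hρ hs.1
  rw [h0] at h1
  norm_num at h1
  linarith

/-- `H` may decay, but not faster than `1/t`: `H e^{3τ}` is nondecreasing, so `(e^{3τ})' = 3H e^{3τ}
≥ 3H(t₀)` and `e^{3τ}` grows at least linearly. -/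
lemma tendsto_integral_hubble (hγ : γ < 2 / 3) (ht₀ : tᵢ < t₀) (hH : 0 < S.hubble t₀)
    (hρ : 0 < S.ρ t₀) : Tendsto (fun t => ∫ s in t₀..t, S.hubble s) atTop atTop := by
  set τ := fun t => ∫ s in t₀..t, S.hubble s with hτ
  have hτ0 : τ t₀ = 0 := by simp [hτ]
  have hτd : ∀ s, t₀ ≤ s → HasDerivAt τ (S.hubble s) s := fun s hs =>
    S.hasDerivAt_integral_hubble ht₀ (ht₀.trans_le hs)
  have hexp : ∀ s, t₀ ≤ s → HasDerivAt (fun s => Real.exp (3 * τ s))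
      (Real.exp (3 * τ s) * (3 * S.hubble s)) s := fun s hs => ((hτd s hs).const_mul 3).exp
  have hd := fun s (hs : t₀ ≤ s) => (S.hasDerivAt_hubble (ht₀.trans_le hs)).mul (hexp s hs)
  have hmono : MonotoneOn (S.hubble * fun s => Real.exp (3 * τ s)) (Ici t₀) := by
    refine monotoneOn_of_deriv_nonneg (convex_Ici t₀)
      (fun t ht => (hd t ht).continuousAt.continuousWithinAt)
      (fun t ht => (hd t (interior_subset ht)).differentiableAt.differentiableWithinAt)
      fun s hs => ?_
    have hs : t₀ ≤ s := interior_subset hs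
    have hs' := ht₀.trans_le hs
    rw [(hd s hs).deriv]
    -- This is `H' + 3H² ≥ 0`, that is `q ≤ 2`.
    have hkey : 0 ≤ -S.hubble s ^ 2 - (∑ a, ∑ b, S.shear s a b ^ 2) / 3
        - (3 * γ - 2) / 6 * S.ρ s - S.J s 0 ^ 2 / 3 + 3 * S.hubble s ^ 2 := by
      nlinarith [S.shear_add_form_le hs', S.sq_form_le_sum s 0, S.density_pos ht₀ hρ hs]
    nlinarith [mul_nonneg hkey (Real.exp_pos (3 * τ s)).le]
  have hd2 : ∀ s, t₀ ≤ s → HasDerivAt (fun s => Real.exp (3 * τ s) - 3 * S.hubble t₀ * s)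
      (Real.exp (3 * τ s) * (3 * S.hubble s) - 3 * S.hubble t₀) s := fun s hs => by
    have := (hexp s hs).fun_sub ((hasDerivAt_id' s).const_mul (3 * S.hubble t₀))
    rwa [mul_one] at this
  have hmono2 : MonotoneOn (fun s => Real.exp (3 * τ s) - 3 * S.hubble t₀ * s) (Ici t₀) := by
    refine monotoneOn_of_deriv_nonneg (convex_Ici t₀)
      (fun t ht => (hd2 t ht).continuousAt.continuousWithinAt)
      (fun t ht => (hd2 t (interior_subset ht)).differentiableAt.differentiableWithinAt)
      fun s hs => ?_
    have hs : t₀ ≤ s := interior_subset hs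
    rw [(hd2 s hs).deriv]
    have := hmono (mem_Ici.2 le_rfl) (mem_Ici.2 hs) hs
    simp only [Pi.mul_apply, hτ0, mul_zero, Real.exp_zero, mul_one] at this
    linarith
  have hlin : Tendsto (fun t => 3 * S.hubble t₀ * t + (1 - 3 * S.hubble t₀ * t₀)) atTop atTop :=
    tendsto_atTop_add_const_right _ _ (tendsto_id.const_mul_atTop (by positivity))
  have hexplim : Tendsto (fun t => Real.exp (3 * τ t)) atTop atTop := by
    refine tendsto_atTop_mono' _ ?_ hlin
    filter_upwards [eventually_ge_atTop t₀] with t ht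
    have := hmono2 (mem_Ici.2 le_rfl) (mem_Ici.2 ht) ht
    simp only [hτ0, mul_zero, Real.exp_zero] at this
    linarith
  have h3 : Tendsto (fun t => 3 * τ t) atTop atTop := Real.tendsto_exp_comp_atTop.1 hexplim
  exact (tendsto_const_mul_atTop_of_pos (by norm_num : (0 : ℝ) < 3)).1 h3

/-- The ratio of the remaining contributions to the Friedmann equation to the fluid density. -/
lemma tendsto_excess (hγ : γ < 2 / 3) (ht₀ : tᵢ < t₀) (hH : 0 < S.hubble t₀) (hρ : 0 < S.ρ t₀) :
    Tendsto (fun t => (3 * S.hubble t ^ 2 - S.ρ t) / S.ρ t) atTop (𝓝 0) := by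
  have hd : ∀ t, t₀ ≤ t → HasDerivAt (fun t => (3 * S.hubble t ^ 2 - S.ρ t) / S.ρ t)
      (-((2 - 3 * γ) * S.hubble t * ((3 * S.hubble t ^ 2 - S.ρ t) / S.ρ t))
        - S.hubble t / S.ρ t * (2 * ∑ a, ∑ b, S.shear t a b ^ 2 + 2 * S.J t 0 ^ 2)) t := by
    intro t ht
    have hp := (S.density_pos ht₀ hρ ht).ne'
    have h1 := S.hasDerivAt_hubble (ht₀.trans_le ht)
    have h2 := S.hasDerivAt_density (ht₀.trans_le ht)
    generalize ∑ a, ∑ b, S.shear t a b ^ 2 = x at h1 ⊢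
    refine ((((h1.fun_pow 2).const_mul 3).fun_sub h2).fun_div h2 hp).congr_deriv ?_
    field_simp
    push_cast
    ring
  refine tendsto_zero_of_deriv_le (κ := 2 - 3 * γ) (by linarith) hd
    (fun t ht => S.hasDerivAt_integral_hubble ht₀ (ht₀.trans_le ht)) (fun t ht => ?_)
    (fun t ht => ?_) (S.tendsto_integral_hubble hγ ht₀ hH hρ)
  · have h1 := S.sum_shear_sq_nonneg t
    have h2 := div_pos (S.hubble_pos ht₀ hH hρ ht) (S.density_pos ht₀ hρ ht)
    have h3 := mul_nonneg h2.le
      (by positivity : 0 ≤ 2 * ∑ a, ∑ b, S.shear t a b ^ 2 + 2 * S.J t 0 ^ 2)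
    linarith
  · exact div_nonneg (by linarith [S.density_le (ht₀.trans_le ht)]) (S.density_pos ht₀ hρ ht).le

lemma shear_add_form_le_excess (ht₀ : tᵢ < t₀) (hρ : 0 < S.ρ t₀) (ht : t₀ ≤ t) :
    ∑ μ, S.J t μ ^ 2 + ∑ a, ∑ b, S.shear t a b ^ 2 ≤
      6 * ((3 * S.hubble t ^ 2 - S.ρ t) / S.ρ t) * S.hubble t ^ 2 := by
  have hp := S.density_pos ht₀ hρ ht
  have hle := S.density_le (ht₀.trans_le ht)
  refine (S.shear_add_form_le (ht₀.trans_le ht)).trans ?_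
  set Z := (3 * S.hubble t ^ 2 - S.ρ t) / S.ρ t with hZ
  have h1 : 3 * S.hubble t ^ 2 - S.ρ t = Z * S.ρ t := by
    rw [hZ]
    field_simp
  have h2 : 0 ≤ Z := div_nonneg (by linarith) hp.le
  rw [h1]
  -- `2Zρ ≤ 6ZH²` because `ρ ≤ 3H²`.
  nlinarith [mul_le_mul_of_nonneg_left hle h2]

lemma tendsto_shear_div_hubble (hγ : γ < 2 / 3) (ht₀ : tᵢ < t₀) (hH : 0 < S.hubble t₀)
    (hρ : 0 < S.ρ t₀) (a b : Fin 3) :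
    Tendsto (fun t => S.shear t a b / S.hubble t) atTop (𝓝 0) := by
  refine tendsto_div_zero_of_sq_le (K := 6) (S.tendsto_excess hγ ht₀ hH hρ) ?_
  filter_upwards [eventually_ge_atTop t₀] with t ht
  refine ⟨S.hubble_pos ht₀ hH hρ ht, ?_⟩
  linarith [S.shear_add_form_le_excess ht₀ hρ ht, S.sq_shear_le_sum t a b, S.sq_form_le_sum t 0,
    sq_nonneg (S.J t 0)]

lemma tendsto_form_div_hubble (hγ : γ < 2 / 3) (ht₀ : tᵢ < t₀) (hH : 0 < S.hubble t₀)
    (hρ : 0 < S.ρ t₀) (μ : Fin 4) :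
    Tendsto (fun t => S.J t μ / S.hubble t) atTop (𝓝 0) := by
  refine tendsto_div_zero_of_sq_le (K := 6) (S.tendsto_excess hγ ht₀ hH hρ) ?_
  filter_upwards [eventually_ge_atTop t₀] with t ht
  refine ⟨S.hubble_pos ht₀ hH hρ ht, ?_⟩
  linarith [S.shear_add_form_le_excess ht₀ hρ ht, S.sq_form_le_sum t μ, S.sum_shear_sq_nonneg t]

lemma tendsto_omegaFluid_one (hγ : γ < 2 / 3) (ht₀ : tᵢ < t₀) (hH : 0 < S.hubble t₀)
    (hρ : 0 < S.ρ t₀) : Tendsto S.omegaFluid atTop (𝓝 1) := by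
  have h := ((S.tendsto_excess hγ ht₀ hH hρ).const_add 1).inv₀ (by norm_num)
  rw [add_zero, inv_one] at h
  refine h.congr' ?_
  filter_upwards [eventually_ge_atTop t₀] with t ht
  have hp := (S.density_pos ht₀ hρ ht).ne'
  have hh := (S.hubble_pos ht₀ hH hρ ht).ne'
  have : 1 + (3 * S.hubble t ^ 2 - S.ρ t) / S.ρ t = 3 * S.hubble t ^ 2 / S.ρ t := by
    field_simp
    ring
  rw [this, inv_div, omegaFluid]

lemma tendsto_decel_fluid (hγ : γ < 2 / 3) (ht₀ : tᵢ < t₀) (hH : 0 < S.hubble t₀)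
    (hρ : 0 < S.ρ t₀) : Tendsto S.decel atTop (𝓝 (3 / 2 * γ - 1)) := by
  have h1 := tendsto_finsetSum Finset.univ fun a _ => tendsto_finsetSum Finset.univ fun b _ =>
    (S.tendsto_shear_div_hubble hγ ht₀ hH hρ a b).pow 2
  have h2 := (S.tendsto_form_div_hubble hγ ht₀ hH hρ 0).pow 2
  have h3 := (S.tendsto_omegaFluid_one hγ ht₀ hH hρ).const_mul ((3 * γ - 2) / 2)
  -- The Raychaudhuri equation divided by `H²`: `q = (σ² + J₀²)/(3H²) + (3γ - 2)Ω_pf/2`.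
  have h := ((h1.add h2).div_const 3).add h3
  have hlim : ((∑ _a : Fin 3, ∑ _b : Fin 3, (0 : ℝ) ^ 2) + 0 ^ 2) / 3 + (3 * γ - 2) / 2 * 1 =
      3 / 2 * γ - 1 := by
    simp
    ring
  rw [hlim] at h
  refine h.congr' ?_
  filter_upwards [eventually_ge_atTop t₀] with t ht
  have hh := (S.hubble_pos ht₀ hH hρ ht).ne'
  rw [decel, (S.hasDerivAt_hubble (ht₀.trans_le ht)).deriv, omegaFluid]
  simp only [div_pow, ← Finset.sum_div]
  generalize ∑ a, ∑ b, S.shear t a b ^ 2 = x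
  field_simp
  ring

lemma tendsto_structConst_div_hubble (hγ : γ < 2 / 3) (ht₀ : tᵢ < t₀) (hH : 0 < S.hubble t₀)
    (hρ : 0 < S.ρ t₀) (a b c : Fin 3) :
    Tendsto (fun t => structConst S.e t a b c / S.hubble t) atTop (𝓝 0) := by
  set W := fun t => ∑ a, ∑ b, ∑ c, structConst S.e t a b c ^ 2 with hW
  set W' := fun t => ∑ a, ∑ b, ∑ c, 2 * structConst S.e t a b c *
    (∑ d, frameRate S.e t d b * structConst S.e t a d c
      + ∑ d, frameRate S.e t d c * structConst S.e t a b d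
      - ∑ d, frameRate S.e t a d * structConst S.e t d b c) with hW'
  have hWd : ∀ t, t₀ ≤ t → HasDerivAt W (W' t) t := fun t ht =>
    HasDerivAt.fun_sum fun a _ => HasDerivAt.fun_sum fun b _ => HasDerivAt.fun_sum fun c _ => by
      simpa using (hasDerivAt_structConst S.contDiff_e (ht₀.trans_le ht) a b c).fun_pow 2
  have hW0 : ∀ t, 0 ≤ W t := fun t => Finset.sum_nonneg fun _ _ => Finset.sum_nonneg fun _ _ =>
    Finset.sum_nonneg fun _ _ => sq_nonneg _
  have hκ : 0 < 2 - 3 * γ := by linarith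
  -- The normalized rate of `W/H²` is at most `18ε + 2q`, and `2q < -(2 - 3γ) + 18ε`. The errors
  -- total `36ε`, half of `2 - 3γ`, which leaves the decay rate `(2 - 3γ)/2`.
  set ε := (2 - 3 * γ) / 72 with hε
  have hε0 : 0 < ε := by positivity
  have hsmall : ∀ᶠ t in atTop, ∀ a b, |S.shear t a b / S.hubble t| < ε := by
    refine eventually_all.2 fun a => eventually_all.2 fun b => ?_
    have := (S.tendsto_shear_div_hubble hγ ht₀ hH hρ a b).abs
    rw [abs_zero] at this
    exact this.eventually_lt_const hε0
  have hq : ∀ᶠ t in atTop, S.decel t < 3 / 2 * γ - 1 + 9 * ε :=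
    (S.tendsto_decel_fluid hγ ht₀ hH hρ).eventually_lt_const (by linarith)
  obtain ⟨T, hT⟩ := eventually_atTop.1 ((eventually_ge_atTop t₀).and (hsmall.and hq))
  have hVd : ∀ t, T ≤ t → HasDerivAt (fun t => W t / S.hubble t ^ 2)
      ((W' t + 2 * (1 + S.decel t) * S.hubble t * W t) / S.hubble t ^ 2) t := by
    intro t ht
    have ht' := (hT t ht).1
    have hh := (S.hubble_pos ht₀ hH hρ ht').ne'
    have h1 := (S.hasDerivAt_hubble (ht₀.trans_le ht')).differentiableAt.hasDerivAt
    refine ((hWd t ht').fun_div (h1.fun_pow 2) (pow_ne_zero 2 hh)).congr_deriv ?_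
    rw [decel]
    field_simp
    push_cast
    ring
  have hV : Tendsto (fun t => W t / S.hubble t ^ 2) atTop (𝓝 0) := by
    refine tendsto_zero_of_deriv_le (κ := (2 - 3 * γ) / 2) (by linarith) hVd
      (fun t ht => S.hasDerivAt_integral_hubble ht₀ (ht₀.trans_le (hT t ht).1)) (fun t ht => ?_)
      (fun t _ => div_nonneg (hW0 t) (sq_nonneg _)) (S.tendsto_integral_hubble hγ ht₀ hH hρ)
    obtain ⟨ht', hs, hdec⟩ := hT t ht
    have hh := S.hubble_pos ht₀ hH hρ ht'
    have hrate : W' t ≤ (-2 * S.hubble t + 18 * (ε * S.hubble t)) * W t := by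
      refine sum_structConst_rate_le (S.shear_eq t) (fun a b => ?_) _
      have := (hs a b).le
      rwa [abs_div, abs_of_pos hh, div_le_iff₀ hh] at this
    rw [← mul_div_assoc, ← neg_div]
    refine div_le_div_of_nonneg_right ?_ (sq_nonneg _)
    have h1 := mul_le_mul_of_nonneg_right hdec.le (mul_nonneg hh.le (hW0 t))
    have h2 : (2 - 3 * γ) = 72 * ε := by rw [hε]; ring
    nlinarith
  refine tendsto_div_zero_of_sq_le (K := 1) hV ?_
  filter_upwards [eventually_ge_atTop t₀] with t ht
  have hh := S.hubble_pos ht₀ hH hρ ht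
  refine ⟨hh, ?_⟩
  rw [one_mul, div_mul_cancel₀ _ (pow_pos hh 2).ne']
  calc structConst S.e t a b c ^ 2 ≤ ∑ c, structConst S.e t a b c ^ 2 :=
        Finset.single_le_sum (f := fun c => structConst S.e t a b c ^ 2)
          (fun _ _ => sq_nonneg _) (Finset.mem_univ c)
    _ ≤ ∑ b, ∑ c, structConst S.e t a b c ^ 2 :=
        Finset.single_le_sum (f := fun b => ∑ c, structConst S.e t a b c ^ 2)
          (fun _ _ => Finset.sum_nonneg fun _ _ => sq_nonneg _) (Finset.mem_univ b)
    _ ≤ W t :=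
        Finset.single_le_sum (f := fun a => ∑ b, ∑ c, structConst S.e t a b c ^ 2)
          (fun _ _ => Finset.sum_nonneg fun _ _ => Finset.sum_nonneg fun _ _ => sq_nonneg _)
          (Finset.mem_univ a)

end JFormSpacetime

end Bianchi

/-- Second no-hair theorem: every initially expanding Bianchi space-time of solvable type
(types I–VII_h) with a `j`-form and a perfect fluid with `0 ≤ γ < 2/3` keeps expanding, the
dimensionless time `τ` with `dτ = H dt` runs to infinity, and the space-time is asymptotically quasi
de Sitter with `q → 3γ/2 - 1 < 0`. -/
theorem theorem2 {𝔤 : Type*} [LieRing 𝔤] [LieAlgebra ℝ 𝔤] [LieAlgebra.IsSolvable 𝔤]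
    {γ tᵢ : ℝ} (hγ₀ : 0 ≤ γ) (hγ : γ < 2 / 3)
    (S : Bianchi.JFormSpacetime 𝔤 γ tᵢ)
    (t₀ : ℝ) (ht₀ : tᵢ < t₀) (hH : 0 < S.hubble t₀) (hρ : 0 < S.ρ t₀) :
    (∀ t, t₀ ≤ t → 0 < S.hubble t) ∧
    Tendsto (fun t => ∫ s in t₀..t, S.hubble s) atTop atTop ∧
    S.AsymptoticallyQuasiDeSitter (3 / 2 * γ - 1) := by
  have hpos := fun t (ht : t₀ ≤ t) => S.hubble_pos ht₀ hH hρ ht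
  exact ⟨hpos, S.tendsto_integral_hubble hγ ht₀ hH hρ,
    { accelerating := by linarith
      expanding := (eventually_ge_atTop t₀).mono hpos
      tendsto_decel := S.tendsto_decel_fluid hγ ht₀ hH hρ
      tendsto_omegaFluid := S.tendsto_omegaFluid_one hγ ht₀ hH hρ
      tendsto_shear := S.tendsto_shear_div_hubble hγ ht₀ hH hρ
      tendsto_structure := S.tendsto_structConst_div_hubble hγ ht₀ hH hρ
      tendsto_form := S.tendsto_form_div_hubble hγ ht₀ hH hρ }⟩
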